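/- Let $G$ be a second-countable, locally compact (Hausdorff), non-compact topological group with left Haar measure $\mu$. Let $1\le p<+\infty$, let $S\subset G$, and let $\Gamma\subset\mathbb{C}$ be such that $\Gamma\setminus\{0\}$ is non-empty. Let $\omega:G\to(0,+\infty)$ be a continuous function such that for every $s\in G$ $$M(s):=\sup_{t\in G}\frac{\omega(st)}{\omega(t)}<+\infty\quad\text{and}\quad R(s):=\sup_{t\in G}\frac{\omega(ts)}{\omega(t)}<+\infty .$$ Let $L^p(G,\omega)$ be the space of (classes modulo equality $\mu$-almost everywhere of) measurable functions $f:G\to\mathbb{C}$ with $\|f\|_{p,\omega}:=\left(\int_G|f(t)|^p\omega(t)^p\,d\mu(t)\right)^{1/p}<+\infty$, and put $(T_sf)(t)=f(s^{-1}t)$ for $s,t\in G$. A vector $f\in L^p(G,\omega)$ is called $(\Gamma,S)$-dense if the set $\{\lambda T_sf:\lambda\in\Gamma,\ s\in S\}$ is dense in $L^p(G,\omega)$. Then the following conditions are equivalent: (1) There exists a $(\Gamma,S)$-dense vector in $L^p(G,\omega)$. (2) For every compact set $K\subset G$, there exist sequences $(s_n)_{n\ge1}\subset S$ and $(\lambda_n)_{n\ge1}\subset\Gamma\setminus\{0\}$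 such that $$\lim_{n\to+\infty}|\lambda_n|\sup_{t\in K}\omega(s_nt)=0\quad\text{and}\quad\lim_{n\to+\infty}\frac1{|\lambda_n|}\sup_{t\in K}\omega(s_n^{-1}t)=0$$ (with the convention $\sup\emptyset=0$). (3) There exist sequences $(s_n)_{n\ge1}\subset S$ and $(\lambda_n)_{n\ge1}\subset\Gamma\setminus\{0\}$ such that $$\lim_{n\to+\infty}|\lambda_n|\,\omega(s_n)=0\quad\text{and}\quad\lim_{n\to+\infty}\frac1{|\lambda_n|}\,\omega(s_n^{-1})=0 .$$ -/

import Mathlib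

open MeasureTheory Filter Topology
open scoped ENNReal

noncomputable section

/-- The measure `ω ^ p dμ`, so that `∫ |f| ^ p d(weightedMeasure μ p ω) = ∫ |f| ^ p ω ^ p dμ`. -/
def weightedMeasure {G : Type*} [MeasurableSpace G] (μ : Measure G) (p : ℝ≥0∞) (ω : G → ℝ) :
    Measure G :=
  μ.withDensity (fun t => ENNReal.ofReal (ω t ^ p.toReal))

/-- The weighted space `L^p(G, ω)` of complex functions (modulo almost everywhere equality), with
norm `(∫ |f| ^ p ω ^ p dμ) ^ (1 / p)`. -/
abbrev WeightedLp {G : Type*} [MeasurableSpace G] (μ : Measure G) (p : ℝ≥0∞) (ω : G → ℝ) :=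
  Lp ℂ p (weightedMeasure μ p ω)

/-- The left translate `(T_s f)(t) = f(s⁻¹ t)`. -/
def leftTranslate {G : Type*} [Group G] (s : G) (f : G → ℂ) : G → ℂ :=
  fun t => f (s⁻¹ * t)

/-- The `(Γ, S)`-orbit `{λ T_s f : λ ∈ Γ, s ∈ S}` of `f`, as a set of elements of `L^p(G, ω)`. -/
def translateOrbit {G : Type*} [Group G] [MeasurableSpace G] {μ : Measure G} {p : ℝ≥0∞}
    {ω : G → ℝ} (Γ : Set ℂ) (S : Set G) (f : WeightedLp μ p ω) : Set (WeightedLp μ p ω) :=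
  {h | ∃ c ∈ Γ, ∃ s ∈ S, (h : G → ℂ) =ᵐ[weightedMeasure μ p ω] c • leftTranslate s f}

/-- `f` is a `(Γ, S)`-dense vector of `L^p(G, ω)`: its `(Γ, S)`-orbit is dense. -/
def IsDenseVector {G : Type*} [Group G] [MeasurableSpace G] {μ : Measure G} {p : ℝ≥0∞}
    [Fact (1 ≤ p)] {ω : G → ℝ} (Γ : Set ℂ) (S : Set G) (f : WeightedLp μ p ω) : Prop :=
  Dense (translateOrbit Γ S f)

/-- The essential supremum of `ω(st) / ω(t)` over `t ∈ G`. -/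
def essLeftBound {G : Type*} [Group G] [MeasurableSpace G] (μ : Measure G) (ω : G → ℝ) (s : G) :
    ℝ≥0∞ :=
  essSup (fun t => ENNReal.ofReal (ω (s * t) / ω t)) μ

/-- `M(s)`, the supremum of `ω(st) / ω(t)` over `t ∈ G`. -/
def leftBound {G : Type*} [Group G] (ω : G → ℝ) (s : G) : ℝ≥0∞ :=
  ⨆ t : G, ENNReal.ofReal (ω (s * t) / ω t)

/-- `R(s)`, the supremum of `ω(ts) / ω(t)` over `t ∈ G`. -/
def rightBound {G : Type*} [Group G] (ω : G → ℝ) (s : G) : ℝ≥0∞ :=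
  ⨆ t : G, ENNReal.ofReal (ω (t * s) / ω t)

/-- `(G, S, p, ω, Γ)` is an admissible tuple. The group `G` is second-countable, locally compact
and non-compact through the type classes, with a left Haar measure `μ`; also `1 ≤ p`. -/
structure IsAdmissibleTuple {G : Type*} [Group G] [TopologicalSpace G] [IsTopologicalGroup G]
    [T2Space G] [LocallyCompactSpace G] [SecondCountableTopology G] [NoncompactSpace G]
    [MeasurableSpace G] [BorelSpace G] (μ : Measure G) [μ.IsHaarMeasure]
    (S : Set G) (p : ℝ≥0∞) [Fact (1 ≤ p)] (ω : G → ℝ) (Γ : Set ℂ) : Prop where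
  /-- the exponent is finite -/
  p_ne_top : p ≠ ∞
  /-- `Γ` contains a non-zero number -/
  nonempty : (Γ \ {0}).Nonempty
  /-- the weight is positive -/
  pos : ∀ t, 0 < ω t
  /-- the weight is locally `p`-integrable -/
  locallyIntegrable : LocallyIntegrable (fun t => ω t ^ p.toReal) μ
  /-- the weight is `S`-admissible -/
  admissible : ∀ s ∈ S, essLeftBound μ ω s < ∞

end

open scoped Pointwise

set_option linter.unusedSectionVars false

/-! By Baire, finiteness of the translation bounds at each point makes them uniform on compact sets.
Hence `ω (s * u)` is comparable to `ω s * ω u` for `u` in a compact set, which makes the conditions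
at a point and on compact sets equivalent.

From the sequences to a dense vector (`exists_isDenseVector`): if `x`, `y` vanish off compact sets,
then `x + c⁻¹ T_{s⁻¹} y` is close to `x`, and `c T_s` sends it to `c T_s x + y`, close to `y`.
Birkhoff's theorem applies.

Conversely (`exists_small_of_isDenseVector`), let `c T_s f` be close to `h ≠ 0` supported in a
compact `K`, with `s` far out. On `sK`, where `h` vanishes, it carries the mass of `f` on `K`, so
`‖c‖ ω(s)` is small. On `K` it must reproduce `h` from the tail of `f`, so `ω(s⁻¹) / ‖c‖` is small.
The delicate point is that `s` can be taken far out (`exists_translate_notMem_near`). -/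

/-- A continuous positive weight whose left and right translates are all comparable to it. -/
structure IsModerateWeight {G : Type*} [Group G] [TopologicalSpace G] (ω : G → ℝ) : Prop where
  continuous : Continuous ω
  pos : ∀ t, 0 < ω t
  left : ∀ s, ∃ C : ℝ, ∀ t, ω (s * t) ≤ C * ω t
  right : ∀ s, ∃ C : ℝ, ∀ t, ω (t * s) ≤ C * ω t

/-! ### Uniform bounds for the weight on compact sets -/

section Bounds

variable {G : Type*} [Group G] [TopologicalSpace G] [IsTopologicalGroup G]

/-- An exhaustion of a locally compact group by closed sets, submultiplicative in its index,
absorbs every compact set. -/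
theorem IsCompact.subset_of_mul_subset_exhaustion [T2Space G] [LocallyCompactSpace G]
    {A : ℕ → Set G} (hmono : Monotone A) (hclosed : ∀ n, IsClosed (A n))
    (hunion : ⋃ n, A n = Set.univ)
    (hmul : ∀ m n, ∀ x ∈ A m, ∀ y ∈ A n, x * y ∈ A (m * n)) {K : Set G} (hK : IsCompact K) :
    ∃ n, K ⊆ A n := by
  -- By Baire some `A n` has an interior point `x`; moving it to `k` by `k * x⁻¹ ∈ A m` puts `k` in
  -- the interior of `A (m * n)`.
  obtain ⟨n, x, hx⟩ := nonempty_interior_of_iUnion_of_closed hclosed hunion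
  obtain ⟨m, hm⟩ := hK.elim_directed_cover (fun m => interior (A m)) (fun m => isOpen_interior)
    (by
      intro k _
      obtain ⟨m, hm⟩ := Set.mem_iUnion.1 (hunion.symm ▸ Set.mem_univ (k * x⁻¹))
      refine Set.mem_iUnion.2 ⟨m * n, mem_interior_iff_mem_nhds.2 ?_⟩
      have hc : Tendsto (fun y => (k * x⁻¹)⁻¹ * y) (𝓝 k) (𝓝 x) := by
        have : Continuous fun y : G => (k * x⁻¹)⁻¹ * y := by fun_prop
        simpa using this.tendsto k
      filter_upwards [hc (mem_interior_iff_mem_nhds.1 hx)] with y hy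
      have := hmul m n _ hm _ hy
      rwa [mul_inv_cancel_left] at this)
    (Monotone.directed_le fun i j hij => interior_mono (hmono hij))
  exact ⟨m, hm.trans interior_subset⟩

variable {ω : G → ℝ}

/-- The sets where the translation bound is at most `n` are closed by continuity of `ω`, and bounds
multiply under composition of translations, so the exhaustion lemma applies. -/
theorem IsModerateWeight.exists_left_bound [T2Space G] [LocallyCompactSpace G]
    (hω : IsModerateWeight ω) {K : Set G} (hK : IsCompact K) :
    ∃ C > 0, ∀ s ∈ K, ∀ t, ω (s * t) ≤ C * ω t := by
  have hc := hω.continuous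
  obtain ⟨n, hn⟩ := hK.subset_of_mul_subset_exhaustion
    (A := fun n : ℕ => {s | ∀ t, ω (s * t) ≤ n * ω t})
    (fun m n hmn s hs t => (hs t).trans
      (mul_le_mul_of_nonneg_right (by exact_mod_cast hmn) (hω.pos t).le))
    (fun n => by
      simp only [Set.ofPred_forall]
      exact isClosed_iInter fun t => isClosed_le (by fun_prop) (by fun_prop))
    (by
      refine Set.eq_univ_of_forall fun s => Set.mem_iUnion.2 ?_
      obtain ⟨C, hC⟩ := hω.left s
      obtain ⟨n, hn⟩ := exists_nat_ge C
      exact ⟨n, fun t => (hC t).trans (mul_le_mul_of_nonneg_right hn (hω.pos t).le)⟩)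
    (fun m n x hx y hy t => by
      rw [mul_assoc]
      refine (hx _).trans ?_
      push_cast
      rw [mul_assoc]
      exact mul_le_mul_of_nonneg_left (hy t) (by positivity))
  -- `n` may be `0` when `K` is empty; `n + 1` keeps the constant positive.
  exact ⟨n + 1, by positivity, fun s hs t => (hn hs t).trans
    (mul_le_mul_of_nonneg_right (by linarith) (hω.pos t).le)⟩

theorem IsModerateWeight.exists_right_bound [T2Space G] [LocallyCompactSpace G]
    (hω : IsModerateWeight ω) {K : Set G} (hK : IsCompact K) :
    ∃ C > 0, ∀ s ∈ K, ∀ t, ω (t * s) ≤ C * ω t := by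
  have hc := hω.continuous
  obtain ⟨n, hn⟩ := hK.subset_of_mul_subset_exhaustion
    (A := fun n : ℕ => {s | ∀ t, ω (t * s) ≤ n * ω t})
    (fun m n hmn s hs t => (hs t).trans
      (mul_le_mul_of_nonneg_right (by exact_mod_cast hmn) (hω.pos t).le))
    (fun n => by
      simp only [Set.ofPred_forall]
      exact isClosed_iInter fun t => isClosed_le (by fun_prop) (by fun_prop))
    (by
      refine Set.eq_univ_of_forall fun s => Set.mem_iUnion.2 ?_
      obtain ⟨C, hC⟩ := hω.right s
      obtain ⟨n, hn⟩ := exists_nat_ge C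
      exact ⟨n, fun t => (hC t).trans (mul_le_mul_of_nonneg_right hn (hω.pos t).le)⟩)
    (fun m n x hx y hy t => by
      rw [← mul_assoc]
      refine (hy _).trans ?_
      push_cast
      rw [mul_comm (m : ℝ), mul_assoc]
      exact mul_le_mul_of_nonneg_left (hx t) (by positivity))
  exact ⟨n + 1, by positivity, fun s hs t => (hn hs t).trans
    (mul_le_mul_of_nonneg_right (by linarith) (hω.pos t).le)⟩

/-- On a compact set, `ω (s * u)` is comparable to `ω s * ω u`, uniformly in `s`. -/
theorem IsModerateWeight.exists_mul_bounds [T2Space G] [LocallyCompactSpace G]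
    (hω : IsModerateWeight ω) {K : Set G} (hK : IsCompact K) :
    ∃ C > 0, ∀ u ∈ K, ∀ s, ω (s * u) ≤ C * (ω s * ω u) ∧ ω s * ω u ≤ C * ω (s * u) := by
  obtain ⟨A, hA, hAK⟩ := hω.exists_right_bound hK
  obtain ⟨B, hB, hBK⟩ := hω.exists_right_bound hK.inv
  have h1 := hω.pos 1
  -- One summand serves each inequality; `ω 1` enters because `ω u` is compared with it.
  refine ⟨A * B / ω 1 + B * (A * ω 1), by positivity, fun u hu s => ?_⟩
  have hs := hω.pos s
  have hu' := hω.pos u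
  have hsu := hω.pos (s * u)
  have a : ω (s * u) ≤ A * ω s := hAK u hu s
  have b : ω s ≤ B * ω (s * u) := by simpa using hBK u⁻¹ (by simpa using hu) (s * u)
  have c : ω 1 ≤ B * ω u := by simpa using hBK u⁻¹ (by simpa using hu) u
  have d : ω u ≤ A * ω 1 := by simpa using hAK u hu 1
  constructor
  · calc ω (s * u) ≤ A * ω s * 1 := by simpa using a
      _ ≤ A * ω s * (B * ω u / ω 1) := by
          gcongr
          rwa [one_le_div h1]
      _ = A * B / ω 1 * (ω s * ω u) := by ring
      _ ≤ _ := by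
          gcongr
          linarith [show 0 < B * (A * ω 1) by positivity]
  · calc ω s * ω u ≤ B * ω (s * u) * (A * ω 1) := by gcongr
      _ = B * (A * ω 1) * ω (s * u) := by ring
      _ ≤ _ := by
          gcongr
          linarith [show 0 < A * B / ω 1 by positivity]

theorem le_mul_of_iSup_ofReal_div_lt_top {ι : Type*} {a b : ι → ℝ} (hb : ∀ i, 0 < b i)
    (h : ⨆ i, ENNReal.ofReal (a i / b i) < ∞) : ∃ C : ℝ, ∀ i, a i ≤ C * b i := by
  refine ⟨(⨆ i, ENNReal.ofReal (a i / b i)).toReal, fun i => ?_⟩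
  rw [← div_le_iff₀ (hb i)]
  exact (ENNReal.ofReal_le_iff_le_toReal h.ne).1
    (le_iSup (fun i => ENNReal.ofReal (a i / b i)) i)

end Bounds

/-! ### Seminorms of restrictions to sets -/

section NormOn

variable {G : Type*} [MeasurableSpace G] {μ : Measure G} {p : ℝ≥0∞} {ω : G → ℝ}

theorem eLpNorm_restrict_ne_top (A : Set G) (g : WeightedLp μ p ω) :
    eLpNorm g p ((weightedMeasure μ p ω).restrict A) ≠ ∞ :=
  ((eLpNorm_restrict_le _ _ _ _).trans_lt (Lp.eLpNorm_lt_top g)).ne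

variable [Fact (1 ≤ p)]

/-- The norm of the restriction of `g` to `A`. -/
noncomputable def normOn (A : Set G) (g : WeightedLp μ p ω) : ℝ :=
  ‖LpToLpRestrictCLM G ℂ ℂ (weightedMeasure μ p ω) p A g‖

theorem normOn_eq (A : Set G) (g : WeightedLp μ p ω) :
    normOn A g = (eLpNorm g p ((weightedMeasure μ p ω).restrict A)).toReal := by
  rw [normOn, Lp.norm_def, eLpNorm_congr_ae (LpToLpRestrictCLM_coeFn ℂ A g)]

theorem normOn_nonneg (A : Set G) (g : WeightedLp μ p ω) : 0 ≤ normOn A g := norm_nonneg _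

theorem normOn_le_norm (A : Set G) (g : WeightedLp μ p ω) : normOn A g ≤ ‖g‖ := by
  rw [normOn_eq, Lp.norm_def]
  exact ENNReal.toReal_mono (Lp.eLpNorm_ne_top g) (eLpNorm_restrict_le _ _ _ _)

theorem normOn_mono {A B : Set G} (h : A ⊆ B) (g : WeightedLp μ p ω) :
    normOn A g ≤ normOn B g := by
  rw [normOn_eq, normOn_eq]
  exact ENNReal.toReal_mono (eLpNorm_restrict_ne_top B g)
    (eLpNorm_mono_measure _ (Measure.restrict_mono h le_rfl))

theorem normOn_smul (A : Set G) (c : ℂ) (g : WeightedLp μ p ω) :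
    normOn A (c • g) = ‖c‖ * normOn A g := by
  rw [normOn, map_smul, norm_smul, normOn]

theorem normOn_add_le (A : Set G) (g h : WeightedLp μ p ω) :
    normOn A (g + h) ≤ normOn A g + normOn A h := by
  rw [normOn, map_add]
  exact norm_add_le _ _

theorem normOn_le_add_norm_sub (A : Set G) (g h : WeightedLp μ p ω) :
    normOn A g ≤ normOn A h + ‖g - h‖ := by
  calc normOn A g = normOn A (h + (g - h)) := by simp
    _ ≤ normOn A h + normOn A (g - h) := normOn_add_le _ _ _
    _ ≤ _ := by gcongr; exact normOn_le_norm _ _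

theorem norm_le_normOn_add_normOn_compl {A : Set G} (hA : MeasurableSet A)
    (g : WeightedLp μ p ω) : ‖g‖ ≤ normOn A g + normOn Aᶜ g := by
  rw [normOn_eq, normOn_eq, Lp.norm_def, ← ENNReal.toReal_add (eLpNorm_restrict_ne_top A g)
    (eLpNorm_restrict_ne_top Aᶜ g)]
  refine ENNReal.toReal_mono
    (ENNReal.add_ne_top.2 ⟨eLpNorm_restrict_ne_top A g, eLpNorm_restrict_ne_top Aᶜ g⟩) ?_
  rw [← eLpNorm_indicator_eq_eLpNorm_restrict hA,
    ← eLpNorm_indicator_eq_eLpNorm_restrict hA.compl]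
  have hg := Lp.aestronglyMeasurable g
  calc eLpNorm g p (weightedMeasure μ p ω)
      = eLpNorm (A.indicator g + Aᶜ.indicator g) p (weightedMeasure μ p ω) := by
        rw [Set.indicator_self_add_compl]
    _ ≤ _ := eLpNorm_add_le (hg.indicator hA) (hg.indicator hA.compl) Fact.out

theorem normOn_eq_zero_of_ae {A : Set G} {g : WeightedLp μ p ω}
    (h : g =ᵐ[(weightedMeasure μ p ω).restrict A] 0) : normOn A g = 0 := by
  rw [normOn_eq, eLpNorm_congr_ae h]
  simp

theorem normOn_indicatorConstLp_of_disjoint {A K : Set G} (hK : MeasurableSet K)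
    (hKfin : weightedMeasure μ p ω K ≠ ∞) (hA : MeasurableSet A) (h : Disjoint A K) (c : ℂ) :
    normOn A (indicatorConstLp p hK hKfin c : WeightedLp μ p ω) = 0 := by
  refine normOn_eq_zero_of_ae ?_
  filter_upwards [ae_restrict_of_ae (indicatorConstLp_coeFn (p := p) (c := c) (hs := hK)
    (hμs := hKfin)),
    ae_restrict_mem hA] with x hx hxA
  rw [hx, Set.indicator_of_notMem (h.notMem_of_mem_left hxA)]
  rfl

end NormOn

/-! ### Translation operators on the weighted space -/

theorem IsModerateWeight.continuous_rpow {G : Type*} [Group G] [TopologicalSpace G] {ω : G → ℝ}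
    (hω : IsModerateWeight ω) (q : ℝ) : Continuous fun t => ω t ^ q :=
  hω.continuous.rpow_const fun t => Or.inl (hω.pos t).ne'

section Measure

variable {G : Type*} [Group G] [TopologicalSpace G] [IsTopologicalGroup G]
  [LocallyCompactSpace G] [SecondCountableTopology G]
  [MeasurableSpace G] [BorelSpace G] {μ : Measure G} {p : ℝ≥0∞} {ω : G → ℝ}

theorem IsModerateWeight.measurable_density (hω : IsModerateWeight ω) (q : ℝ) :
    Measurable fun t => ENNReal.ofReal (ω t ^ q) :=
  (hω.continuous_rpow q).measurable.ennreal_ofReal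

theorem IsModerateWeight.absolutelyContinuous (hω : IsModerateWeight ω) :
    μ ≪ weightedMeasure μ p ω :=
  withDensity_absolutelyContinuous' (hω.measurable_density _).aemeasurable
    (ae_of_all _ fun t => by simpa using Real.rpow_pos_of_pos (hω.pos t) _)

theorem IsModerateWeight.isLocallyFiniteMeasure [IsLocallyFiniteMeasure μ]
    (hω : IsModerateWeight ω) : IsLocallyFiniteMeasure (weightedMeasure μ p ω) :=
  IsLocallyFiniteMeasure.withDensity_ofReal (hω.continuous_rpow _)

/-- The weighted measure is not invariant, but its null sets are those of `μ`, so translation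
respects almost everywhere equality. -/
theorem IsModerateWeight.quasiMeasurePreserving [μ.IsMulLeftInvariant]
    (hω : IsModerateWeight ω) (s : G) :
    Measure.QuasiMeasurePreserving (fun t => s * t) (weightedMeasure μ p ω)
      (weightedMeasure μ p ω) :=
  ((measurePreserving_mul_left μ s).quasiMeasurePreserving).mono
    (withDensity_absolutelyContinuous _ _) hω.absolutelyContinuous

/-- Translation by `s` maps the part of `g` on `B` to the part of `leftTranslate s g` on `s B`,
with norm controlled by the growth of the weight. -/
theorem IsModerateWeight.eLpNorm_leftTranslate_le [μ.IsMulLeftInvariant]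
    (hω : IsModerateWeight ω) (hp0 : p ≠ 0) (hp : p ≠ ∞) (s : G) (g : G → ℂ) {A B : Set G}
    (hA : MeasurableSet A) (hB : MeasurableSet B) {C : ℝ} (hC : 0 ≤ C)
    (hAB : ∀ t ∈ A, s⁻¹ * t ∈ B ∧ ω t ≤ C * ω (s⁻¹ * t)) :
    eLpNorm (leftTranslate s g) p ((weightedMeasure μ p ω).restrict A) ≤
      ENNReal.ofReal C * eLpNorm g p ((weightedMeasure μ p ω).restrict B) := by
  have hq : 0 < p.toReal := ENNReal.toReal_pos hp0 hp
  set q := p.toReal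
  set w : G → ℝ≥0∞ := fun t => ENNReal.ofReal (ω t ^ q) with hw
  have key : ∀ (f : G → ℂ) {E : Set G}, MeasurableSet E →
      ∫⁻ t, ‖f t‖ₑ ^ q ∂((weightedMeasure μ p ω).restrict E) =
        ∫⁻ t, E.indicator (fun t => w t * ‖f t‖ₑ ^ q) t ∂μ := by
    intro f E hE
    rw [weightedMeasure, restrict_withDensity hE,
      lintegral_withDensity_eq_lintegral_mul_non_measurable _ (hω.measurable_density _)
        (ae_of_all _ fun _ => ENNReal.ofReal_lt_top), lintegral_indicator hE]
    rfl
  have main : ∫⁻ t, ‖leftTranslate s g t‖ₑ ^ q ∂((weightedMeasure μ p ω).restrict A) ≤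
      ENNReal.ofReal C ^ q * ∫⁻ t, ‖g t‖ₑ ^ q ∂((weightedMeasure μ p ω).restrict B) := by
    -- Invariance of `μ` shifts the right-hand integral by `s⁻¹`, leaving a pointwise comparison of
    -- integrands.
    rw [key _ hA, key _ hB, ← lintegral_mul_left_eq_self (μ := μ) (B.indicator _) s⁻¹,
      ← lintegral_const_mul' _ _ (by simp [hq.le])]
    refine lintegral_mono fun t => ?_
    by_cases ht : t ∈ A
    · obtain ⟨h1, h2⟩ := hAB t ht
      simp only [Set.indicator_of_mem ht, Set.indicator_of_mem h1, leftTranslate]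
      rw [← mul_assoc]
      gcongr
      rw [hw, ENNReal.ofReal_rpow_of_nonneg hC hq.le, ← ENNReal.ofReal_mul (by positivity),
        ← Real.mul_rpow hC (hω.pos _).le]
      exact ENNReal.ofReal_le_ofReal (Real.rpow_le_rpow (hω.pos _).le h2 hq.le)
    · simp [Set.indicator_of_notMem ht]
  rw [eLpNorm_eq_lintegral_rpow_enorm_toReal hp0 hp, eLpNorm_eq_lintegral_rpow_enorm_toReal hp0 hp]
  calc _ ≤ (ENNReal.ofReal C ^ q *
        ∫⁻ t, ‖g t‖ₑ ^ q ∂((weightedMeasure μ p ω).restrict B)) ^ (1 / q) := by gcongr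
    _ = _ := by
      rw [ENNReal.mul_rpow_of_nonneg _ _ (by positivity), ← ENNReal.rpow_mul,
        mul_one_div_cancel hq.ne', ENNReal.rpow_one]

variable [Fact (1 ≤ p)]

theorem ne_zero_of_fact_one_le : p ≠ 0 :=
  (zero_lt_one.trans_le (Fact.out : 1 ≤ p)).ne'

theorem IsModerateWeight.memLp_leftTranslate [μ.IsMulLeftInvariant]
    (hω : IsModerateWeight ω) (hp : p ≠ ∞) (s : G) (f : WeightedLp μ p ω) :
    MemLp (leftTranslate s f) p (weightedMeasure μ p ω) := by
  refine ⟨((Lp.stronglyMeasurable f).comp_measurable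
    (measurable_const_mul s⁻¹)).aestronglyMeasurable, ?_⟩
  obtain ⟨C, hC⟩ := hω.left s
  have hC0 : 0 ≤ C := by
    have := (hω.pos _).le.trans (hC 1)
    exact nonneg_of_mul_nonneg_left this (hω.pos 1)
  have := hω.eLpNorm_leftTranslate_le (μ := μ) ne_zero_of_fact_one_le hp s f MeasurableSet.univ
    MeasurableSet.univ hC0 (fun t _ => ⟨trivial, by simpa using hC (s⁻¹ * t)⟩)
  simp only [Measure.restrict_univ] at this
  exact this.trans_lt (ENNReal.mul_lt_top ENNReal.ofReal_lt_top (Lp.eLpNorm_lt_top f))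

/-- Left translation as a bounded operator of the weighted space. -/
noncomputable def IsModerateWeight.translate [μ.IsMulLeftInvariant]
    (hω : IsModerateWeight ω) (hp : p ≠ ∞) (s : G) : WeightedLp μ p ω →L[ℂ] WeightedLp μ p ω :=
  LinearMap.mkContinuousOfExistsBound
    { toFun := fun f => (hω.memLp_leftTranslate hp s f).toLp _
      map_add' := fun f g => by
        rw [← MemLp.toLp_add]
        refine MemLp.toLp_congr _ _ ?_
        filter_upwards [(hω.quasiMeasurePreserving s⁻¹).ae
          (p := fun x => (f + g) x = f x + g x) (Lp.coeFn_add f g)] with x hx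
        exact hx
      map_smul' := fun c f => by
        rw [RingHom.id_apply, ← MemLp.toLp_const_smul]
        refine MemLp.toLp_congr _ _ ?_
        filter_upwards [(hω.quasiMeasurePreserving s⁻¹).ae
          (p := fun x => (c • f) x = c • f x) (Lp.coeFn_smul c f)] with x hx
        exact hx }
    (by
      obtain ⟨C, hC⟩ := hω.left s
      have hC0 : 0 ≤ C := by
        have := (hω.pos _).le.trans (hC 1)
        exact nonneg_of_mul_nonneg_left this (hω.pos 1)
      refine ⟨C, fun f => ?_⟩
      have := hω.eLpNorm_leftTranslate_le (μ := μ) ne_zero_of_fact_one_le hp s f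
        MeasurableSet.univ MeasurableSet.univ hC0 (fun t _ => ⟨trivial, by simpa using hC (s⁻¹ * t)⟩)
      simp only [Measure.restrict_univ] at this
      have h2 := ENNReal.toReal_mono
        (ENNReal.mul_ne_top ENNReal.ofReal_ne_top (Lp.eLpNorm_ne_top f)) this
      rw [ENNReal.toReal_mul, ENNReal.toReal_ofReal hC0] at h2
      rw [← Lp.norm_toLp _ (hω.memLp_leftTranslate hp s f), ← Lp.norm_def] at h2
      exact h2)

section Translate

variable [μ.IsMulLeftInvariant] (hω : IsModerateWeight ω) (hp : p ≠ ∞)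

theorem IsModerateWeight.coeFn_translate (s : G) (f : WeightedLp μ p ω) :
    hω.translate hp s f =ᵐ[weightedMeasure μ p ω] leftTranslate s f :=
  MemLp.coeFn_toLp (hω.memLp_leftTranslate hp s f)

theorem IsModerateWeight.translate_mul (s t : G) (f : WeightedLp μ p ω) :
    hω.translate hp (s * t) f = hω.translate hp s (hω.translate hp t f) := by
  ext1
  refine (hω.coeFn_translate hp _ _).trans ?_
  refine EventuallyEq.trans ?_ (hω.coeFn_translate hp _ _).symm
  filter_upwards [(hω.quasiMeasurePreserving s⁻¹).ae (hω.coeFn_translate hp t f)] with x hx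
  simp [leftTranslate, hx, mul_assoc]

theorem IsModerateWeight.translate_one (f : WeightedLp μ p ω) :
    hω.translate hp 1 f = f := by
  ext1
  refine (hω.coeFn_translate hp _ _).trans (ae_of_all _ fun x => ?_)
  simp [leftTranslate]

theorem IsModerateWeight.mem_translateOrbit_iff {Γ : Set ℂ} {S : Set G} {f h : WeightedLp μ p ω} :
    h ∈ translateOrbit Γ S f ↔ ∃ c ∈ Γ, ∃ s ∈ S, h = c • hω.translate hp s f := by
  refine exists_congr fun c => and_congr_right fun _ => exists_congr fun s =>
    and_congr_right fun _ => ?_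
  have : ⇑(c • hω.translate hp s f) =ᵐ[weightedMeasure μ p ω] c • leftTranslate s f :=
    (Lp.coeFn_smul _ _).trans ((hω.coeFn_translate hp s f).const_smul c)
  exact ⟨fun h => Lp.ext (h.trans this.symm), fun h => h ▸ this⟩

end Translate

theorem IsModerateWeight.normOn_translate_le [μ.IsMulLeftInvariant]
    (hω : IsModerateWeight ω) (hp : p ≠ ∞) (s : G) (g : WeightedLp μ p ω) {A B : Set G}
    (hA : MeasurableSet A) (hB : MeasurableSet B) {C : ℝ} (hC : 0 ≤ C)
    (hAB : ∀ t ∈ A, s⁻¹ * t ∈ B ∧ ω t ≤ C * ω (s⁻¹ * t)) :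
    normOn A (hω.translate hp s g) ≤ C * normOn B g := by
  rw [normOn_eq, normOn_eq, eLpNorm_congr_ae (ae_restrict_of_ae (hω.coeFn_translate hp s g)),
    ← ENNReal.toReal_ofReal hC, ← ENNReal.toReal_mul]
  exact ENNReal.toReal_mono
    (ENNReal.mul_ne_top ENNReal.ofReal_ne_top (eLpNorm_restrict_ne_top B g))
    (hω.eLpNorm_leftTranslate_le ne_zero_of_fact_one_le hp s g hA hB hC hAB)

theorem IsModerateWeight.norm_translate_le [μ.IsMulLeftInvariant]
    (hω : IsModerateWeight ω) (hp : p ≠ ∞) (s : G) (g : WeightedLp μ p ω) {C : ℝ} (hC : 0 ≤ C)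
    (h : ∀ t, ω (s * t) ≤ C * ω t) : ‖hω.translate hp s g‖ ≤ C * ‖g‖ := by
  have huniv : ∀ f : WeightedLp μ p ω, normOn Set.univ f = ‖f‖ := fun f => by
    rw [normOn_eq, Measure.restrict_univ, Lp.norm_def]
  rw [← huniv, ← huniv]
  exact hω.normOn_translate_le hp s g .univ .univ hC
    fun t _ => ⟨trivial, by simpa using h (s⁻¹ * t)⟩

/-- Functions vanishing off a compact set are dense in the weighted space. -/
theorem IsModerateWeight.exists_isCompact_normOn_compl_eq_zero [T2Space G] [μ.IsHaarMeasure]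
    (hω : IsModerateWeight ω) (hp : p ≠ ∞) (f : WeightedLp μ p ω) {ε : ℝ} (hε : 0 < ε) :
    ∃ (g : WeightedLp μ p ω) (K : Set G), IsCompact K ∧ normOn Kᶜ g = 0 ∧ ‖f - g‖ ≤ ε := by
  have := hω.isLocallyFiniteMeasure (μ := μ) (p := p)
  have : (weightedMeasure μ p ω).Regular := by
    let := TopologicalSpace.pseudoMetrizableSpacePseudoMetric G
    infer_instance
  obtain ⟨g, hgc, hfg, -, hg⟩ := (Lp.memLp f).exists_hasCompactSupport_eLpNorm_sub_le hp
    (ENNReal.ofReal_pos.2 hε).ne'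
  refine ⟨hg.toLp g, tsupport g, hgc, normOn_eq_zero_of_ae ?_, ?_⟩
  · filter_upwards [ae_restrict_of_ae hg.coeFn_toLp,
      ae_restrict_mem (isClosed_tsupport g).measurableSet.compl] with x hx hxK
    rw [hx]
    exact image_eq_zero_of_notMem_tsupport hxK
  · rw [Lp.norm_def, eLpNorm_congr_ae ((Lp.coeFn_sub _ _).trans
      ((EventuallyEq.refl _ _).sub hg.coeFn_toLp))]
    exact ENNReal.toReal_le_of_le_ofReal hε.le hfg

end Measure

/-! ### Transitivity and construction of a dense vector -/

/-- Birkhoff's transitivity theorem for a sequence of continuous maps. -/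
theorem exists_dense_range_of_transitive {X Y : Type*} [TopologicalSpace X] [BaireSpace X]
    [Nonempty X] [TopologicalSpace Y] [SecondCountableTopology Y] (U : ℕ → X → Y)
    (hU : ∀ n, Continuous (U n))
    (h : ∀ V : Set X, IsOpen V → V.Nonempty → ∀ W : Set Y, IsOpen W → W.Nonempty →
      ∃ n, ∃ x ∈ V, U n x ∈ W) :
    ∃ x, Dense (Set.range fun n => U n x) := by
  let b := TopologicalSpace.countableBasis Y
  have hb : TopologicalSpace.IsTopologicalBasis b := TopologicalSpace.isBasis_countableBasis Y
  -- A point of this intersection has an orbit meeting every basic open set.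
  have hd : Dense (⋂ B : b, ⋃ n, U n ⁻¹' (B : Set Y)) := by
    have : Countable b := (TopologicalSpace.countable_countableBasis Y).to_subtype
    refine dense_iInter_of_isOpen
      (fun B => isOpen_iUnion fun n => (hb.isOpen B.2).preimage (hU n)) fun B => ?_
    rw [dense_iff_inter_open]
    intro V hV hVne
    obtain ⟨n, x, hx, hxB⟩ :=
      h V hV hVne B (hb.isOpen B.2) (TopologicalSpace.nonempty_of_mem_countableBasis B.2)
    exact ⟨x, hx, Set.mem_iUnion.2 ⟨n, hxB⟩⟩
  obtain ⟨x, hx⟩ := hd.nonempty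
  refine ⟨x, hb.dense_iff.2 fun B hB _ => ?_⟩
  obtain ⟨n, hn⟩ := Set.mem_iUnion.1 (Set.mem_iInter.1 hx ⟨B, hB⟩)
  exact ⟨U n x, hn, n, rfl⟩

section

variable {G : Type*} [Group G] [TopologicalSpace G] [IsTopologicalGroup G] [T2Space G]
  [LocallyCompactSpace G] [SecondCountableTopology G] [MeasurableSpace G] [BorelSpace G]
  {μ : Measure G} [μ.IsHaarMeasure] {p : ℝ≥0∞} [Fact (1 ≤ p)] {ω : G → ℝ}

theorem IsModerateWeight.exists_norm_translate_le (hω : IsModerateWeight ω) (hp : p ≠ ∞)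
    {g : WeightedLp μ p ω} {K : Set G} (hK : IsCompact K) (hg : normOn Kᶜ g = 0) :
    ∃ C, ∀ s, ‖hω.translate hp s g‖ ≤ C * ω s := by
  obtain ⟨C, hC, h⟩ := hω.exists_mul_bounds hK
  refine ⟨C * ‖g‖, fun s => ?_⟩
  have hs := hω.pos s
  -- `M` depends on `s`, harmlessly: it only multiplies the zero mass of `g` off `K`.
  obtain ⟨M, hM, h'⟩ := hω.exists_left_bound (isCompact_singleton (x := s))
  let A := (fun t => s⁻¹ * t) ⁻¹' K
  have hKm : MeasurableSet K := hK.measurableSet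
  have hA : MeasurableSet A := measurable_const_mul s⁻¹ hKm
  have h1 : normOn A (hω.translate hp s g) ≤ (C * ω s) * normOn K g :=
    hω.normOn_translate_le hp s g hA hKm (by positivity) fun t ht => ⟨ht, by
      simpa [mul_assoc] using (h _ ht s).1⟩
  have h2 : normOn Aᶜ (hω.translate hp s g) ≤ M * normOn Kᶜ g :=
    hω.normOn_translate_le hp s g hA.compl hKm.compl hM.le fun t ht => ⟨ht, by
      simpa using h' s rfl (s⁻¹ * t)⟩
  calc _ ≤ _ := norm_le_normOn_add_normOn_compl hA _
    _ ≤ (C * ω s) * normOn K g + M * normOn Kᶜ g := add_le_add h1 h2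
    _ ≤ (C * ω s) * ‖g‖ := by
      rw [hg, mul_zero, add_zero]
      gcongr
      exact normOn_le_norm _ _
    _ = _ := by ring

theorem IsModerateWeight.exists_isDenseVector (hω : IsModerateWeight ω) (hp : p ≠ ∞)
    {S : Set G} {Γ : Set ℂ} {s : ℕ → G} {c : ℕ → ℂ} (hs : ∀ n, s n ∈ S)
    (hc : ∀ n, c n ∈ Γ \ {0}) (h1 : Tendsto (fun n => ‖c n‖ * ω (s n)) atTop (𝓝 0))
    (h2 : Tendsto (fun n => 1 / ‖c n‖ * ω ((s n)⁻¹)) atTop (𝓝 0)) :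
    ∃ f : WeightedLp μ p ω, IsDenseVector Γ S f := by
  -- Finite exponent and local finiteness make the weighted space second countable, as Birkhoff's
  -- theorem requires.
  have : Fact (p ≠ ∞) := ⟨hp⟩
  have := hω.isLocallyFiniteMeasure (μ := μ) (p := p)
  have hdense : Dense {g : WeightedLp μ p ω | ∃ K, IsCompact K ∧ normOn Kᶜ g = 0} := by
    intro f
    rw [Metric.mem_closure_iff]
    intro ε hε
    obtain ⟨g, K, hK, hg, hfg⟩ := hω.exists_isCompact_normOn_compl_eq_zero hp f (half_pos hε)
    exact ⟨g, ⟨K, hK, hg⟩, by rw [dist_eq_norm]; linarith⟩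
  obtain ⟨f, hf⟩ := exists_dense_range_of_transitive
    (fun n (f : WeightedLp μ p ω) => c n • hω.translate hp (s n) f)
    (fun n => (hω.translate hp (s n)).continuous.const_smul (c n)) (by
      intro V hV hVne W hW hWne
      obtain ⟨x, hxV, K, hK, hx⟩ := hdense.inter_open_nonempty V hV hVne
      obtain ⟨y, hyW, L, hL, hy⟩ := hdense.inter_open_nonempty W hW hWne
      obtain ⟨A, hA⟩ := hω.exists_norm_translate_le hp hK hx
      obtain ⟨B, hB⟩ := hω.exists_norm_translate_le hp hL hy
      have hx0 : Tendsto (fun n => c n • hω.translate hp (s n) x) atTop (𝓝 0) := by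
        refine squeeze_zero_norm (a := fun n => A * (‖c n‖ * ω (s n))) (fun n => ?_)
          (by simpa using h1.const_mul A)
        rw [norm_smul, mul_left_comm]
        exact mul_le_mul_of_nonneg_left (hA _) (norm_nonneg _)
      have hy0 : Tendsto (fun n => (c n)⁻¹ • hω.translate hp (s n)⁻¹ y) atTop (𝓝 0) := by
        refine squeeze_zero_norm (a := fun n => B * (1 / ‖c n‖ * ω (s n)⁻¹)) (fun n => ?_)
          (by simpa using h2.const_mul B)
        rw [norm_smul, norm_inv, mul_left_comm, one_div]
        exact mul_le_mul_of_nonneg_left (hB _) (by positivity)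
      have e1 : ∀ᶠ n in atTop, x + (c n)⁻¹ • hω.translate hp (s n)⁻¹ y ∈ V := by
        have := hy0.const_add x
        rw [add_zero] at this
        exact this.eventually (hV.mem_nhds hxV)
      have e2 : ∀ᶠ n in atTop, c n • hω.translate hp (s n) x + y ∈ W := by
        have := hx0.add_const y
        rw [zero_add] at this
        exact this.eventually (hW.mem_nhds hyW)
      obtain ⟨n, hn1, hn2⟩ := (e1.and e2).exists
      refine ⟨n, _, hn1, ?_⟩
      convert hn2 using 1
      rw [map_add, map_smul, smul_add, smul_inv_smul₀ (hc n).2, ← hω.translate_mul,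
        mul_inv_cancel, hω.translate_one])
  refine ⟨f, hf.mono ?_⟩
  rintro _ ⟨n, rfl⟩
  exact (hω.mem_translateOrbit_iff hp).2 ⟨c n, (hc n).1, s n, hs n, rfl⟩

/-! ### Necessity: approximation by far translates -/

/-- A dense orbit approximates every compactly supported `h ≠ 0` by translates along elements
outside any given compact set: otherwise `h` and a small perturbation of `h` far away would both be
approximated by multiples of translates of one vector by a compact set of elements. -/
theorem IsModerateWeight.exists_translate_notMem_near [NoncompactSpace G]
    (hω : IsModerateWeight ω) (hp : p ≠ ∞)
    {S : Set G} {Γ : Set ℂ} {f : WeightedLp μ p ω} (hf : IsDenseVector Γ S f)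
    {h : WeightedLp μ p ω} (hh : h ≠ 0) {K : Set G} (hK : IsCompact K) (hhK : normOn Kᶜ h = 0)
    {F : Set G} (hF : IsCompact F) {ε : ℝ} (hε : 0 < ε) :
    ∃ c ∈ Γ, ∃ s ∈ S, s ∉ F ∧ ‖c • hω.translate hp s f - h‖ < ε := by
  by_contra! H
  have approx : ∀ k : WeightedLp μ p ω, ∀ δ > 0,
      ∃ c ∈ Γ, ∃ s ∈ S, ‖c • hω.translate hp s f - k‖ < δ := by
    intro k δ hδ
    obtain ⟨g, hg, hgk⟩ := Metric.mem_closure_iff.1 (hf k) δ hδ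
    obtain ⟨c, hc, s, hs, rfl⟩ := (hω.mem_translateOrbit_iff hp).1 hg
    exact ⟨c, hc, s, hs, by rwa [dist_comm, dist_eq_norm] at hgk⟩
  have hKm : MeasurableSet K := hK.measurableSet
  have hh0 : 0 < ‖h‖ := norm_pos_iff.2 hh
  -- `E` contains every quotient of elements of `F`; `1` is added so that the set `A = aK` below is
  -- itself disjoint from `K`.
  let E : Set G := insert 1 (F * F⁻¹)
  have hE : IsCompact E := (hF.mul hF.inv).insert 1
  obtain ⟨M, hM, hEM⟩ := hω.exists_left_bound hE
  obtain ⟨a, ha⟩ : ∃ a, a ∉ E * K * K⁻¹ := by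
    by_contra! hall
    exact noncompact_univ G (Set.eq_univ_of_forall hall ▸ (hE.mul hK).mul hK.inv)
  let A := (fun t => a⁻¹ * t) ⁻¹' K
  have hA : MeasurableSet A := measurable_const_mul a⁻¹ hKm
  have hAE : ∀ u ∈ E, ∀ t ∈ A, u⁻¹ * t ∈ Kᶜ := by
    intro u hu t ht htK
    refine ha ⟨u * (u⁻¹ * t), Set.mul_mem_mul hu htK, (a⁻¹ * t)⁻¹,
      Set.inv_mem_inv.2 ht, by simp⟩
  have hAK : A ⊆ Kᶜ := fun t ht => by simpa using hAE 1 (Set.mem_insert _ _) t ht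
  have hhA : normOn A h = 0 := le_antisymm ((normOn_mono hAK h).trans hhK.le) (normOn_nonneg _ _)
  set k := hω.translate hp a h with hk
  have hkA : 0 < normOn A k := by
    obtain ⟨D, hD, hDa⟩ := hω.exists_left_bound (isCompact_singleton (x := a⁻¹))
    have h1 : normOn K (hω.translate hp a⁻¹ k) ≤ D * normOn A k :=
      hω.normOn_translate_le hp a⁻¹ k hKm hA hD.le fun t ht => by
        refine ⟨by simpa [A] using ht, ?_⟩
        simpa using hDa a⁻¹ rfl (a * t)
    rw [hk, ← hω.translate_mul, inv_mul_cancel, hω.translate_one] at h1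
    have h2 := norm_le_normOn_add_normOn_compl hKm h
    exact pos_of_mul_pos_right (by linarith) hD.le
  obtain ⟨η, hη, hηk⟩ : ∃ η : ℝ, 0 < η ∧ η * ‖k‖ ≤ ε / 2 := by
    refine ⟨ε / 2 / (‖k‖ + 1), by positivity, ?_⟩
    rw [div_mul_eq_mul_div, div_le_iff₀ (by positivity)]
    exact mul_le_mul_of_nonneg_left (by linarith) (by positivity)
  set h' := h + (η : ℂ) • k with hh'
  have hηn : ‖(η : ℂ)‖ = η := by simp [abs_of_pos hη]
  have hh'h : ‖h' - h‖ ≤ ε / 2 := by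
    rw [hh', add_sub_cancel_left, norm_smul, hηn]
    exact hηk
  -- `Q` will bound `‖c' / c‖`, from `‖c' / c‖ * ‖g‖ ≤ M * ‖g'‖`, `‖g‖ ≥ ‖h‖ / 2` and `‖g'‖ ≤ ‖h'‖ +
  -- ε`.
  set Q := 2 * M * (‖h'‖ + ε) / ‖h‖ with hQ
  have hQ0 : 0 < Q := by positivity
  have hb : 0 < η * normOn A k := by positivity
  -- The three bounds on `δ` respectively force `s, s' ∈ F`, keep `g` away from `0`, and produce the
  -- final contradiction.
  obtain ⟨δ, hδ, hδε, hδh, hδb⟩ :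
      ∃ δ > 0, δ ≤ ε / 2 ∧ δ ≤ ‖h‖ / 2 ∧ (Q * M + 1) * δ < η * normOn A k := by
    refine ⟨min (min (ε / 2) (‖h‖ / 2)) (η * normOn A k / (2 * (Q * M + 1))), by positivity,
      (min_le_left _ _).trans (min_le_left _ _), (min_le_left _ _).trans (min_le_right _ _), ?_⟩
    calc (Q * M + 1) * _ ≤ (Q * M + 1) * (η * normOn A k / (2 * (Q * M + 1))) :=
          mul_le_mul_of_nonneg_left (min_le_right _ _) (by positivity)
      _ = η * normOn A k / 2 := by field_simp
      _ < _ := half_lt_self hb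
  obtain ⟨c, hc, s, hs, hg⟩ := approx h δ hδ
  obtain ⟨c', hc', s', hs', hg'⟩ := approx h' δ hδ
  have hsF : s ∈ F := by
    by_contra hn
    linarith [H c hc s hs hn]
  have hsF' : s' ∈ F := by
    by_contra hn
    have := H c' hc' s' hs' hn
    have := norm_sub_le_norm_sub_add_norm_sub (c' • hω.translate hp s' f) h' h
    linarith
  set g := c • hω.translate hp s f with hgdef
  set g' := c' • hω.translate hp s' f with hgdef'
  have hgn : ‖h‖ / 2 ≤ ‖g‖ := by
    have := norm_sub_norm_le h g
    rw [norm_sub_rev] at this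
    linarith
  have hc0 : c ≠ 0 := by
    rintro rfl
    rw [hgdef, zero_smul, norm_zero] at hgn
    linarith
  have hu : s' * s⁻¹ ∈ E :=
    Set.mem_insert_of_mem _ (Set.mul_mem_mul hsF' (Set.inv_mem_inv.2 hsF))
  have hu' : s * s'⁻¹ ∈ E :=
    Set.mem_insert_of_mem _ (Set.mul_mem_mul hsF (Set.inv_mem_inv.2 hsF'))
  have e1 : g' = (c' / c) • hω.translate hp (s' * s⁻¹) g := by
    rw [hgdef, map_smul, ← hω.translate_mul, inv_mul_cancel_right, smul_smul,
      div_mul_cancel₀ _ hc0]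
  have e2 : hω.translate hp (s * s'⁻¹) g' = (c' / c) • g := by
    rw [hgdef', map_smul, ← hω.translate_mul, inv_mul_cancel_right, hgdef, smul_smul,
      div_mul_cancel₀ _ hc0]
  have hratio : ‖c' / c‖ ≤ Q := by
    have h1 := hω.norm_translate_le hp (s * s'⁻¹) g' hM.le (hEM _ hu')
    rw [e2, norm_smul] at h1
    have h2 : ‖g'‖ ≤ ‖h'‖ + ε := by
      have := norm_sub_norm_le g' h'
      linarith
    rw [hQ, le_div_iff₀ hh0]
    have h3 : ‖c' / c‖ * (‖h‖ / 2) ≤ ‖c' / c‖ * ‖g‖ := by gcongr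
    have h4 : M * ‖g'‖ ≤ M * (‖h'‖ + ε) := by gcongr
    linarith
  have hgK : normOn Kᶜ g ≤ δ := by
    have := normOn_le_add_norm_sub Kᶜ g h
    linarith
  -- On `A`, `g'` is a bounded multiple of a translate of `g` restricted to `Kᶜ`, where `g` is
  -- small; yet `h'` has mass `η * normOn A k` there.
  have hgA : normOn A g' ≤ Q * (M * δ) := by
    rw [e1, normOn_smul]
    have := hω.normOn_translate_le hp (s' * s⁻¹) g hA hKm.compl hM.le fun t ht =>
      ⟨hAE _ hu t ht, by simpa only [mul_inv_cancel_left] using hEM _ hu ((s' * s⁻¹)⁻¹ * t)⟩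
    have h2 : M * normOn Kᶜ g ≤ M * δ := by gcongr
    exact mul_le_mul hratio (this.trans h2) (normOn_nonneg _ _) hQ0.le
  have h1 : η * normOn A k ≤ normOn A h' := by
    have h2 := normOn_add_le A h' ((-1 : ℂ) • h)
    rw [normOn_smul, hhA, mul_zero, add_zero, neg_one_smul, hh', add_neg_cancel_comm, normOn_smul,
      hηn] at h2
    exact h2
  have h2 := normOn_le_add_norm_sub A h' g'
  rw [norm_sub_rev] at h2
  linarith

theorem IsModerateWeight.exists_ne_zero_normOn_compl_eq_zero (hω : IsModerateWeight ω)
    (hp : p ≠ ∞) : ∃ (h : WeightedLp μ p ω) (K : Set G), IsCompact K ∧ h ≠ 0 ∧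
      normOn Kᶜ h = 0 := by
  have := hω.isLocallyFiniteMeasure (μ := μ) (p := p)
  obtain ⟨K, hK, hK1⟩ := exists_compact_mem_nhds (1 : G)
  have hKm : MeasurableSet K := hK.measurableSet
  have hfin : weightedMeasure μ p ω K ≠ ∞ := hK.measure_lt_top.ne
  have hpos : weightedMeasure μ p ω K ≠ 0 := fun h0 =>
    (Measure.measure_pos_of_mem_nhds μ hK1).ne' (hω.absolutelyContinuous h0)
  refine ⟨indicatorConstLp p hKm hfin 1, K, hK, ?_,
    normOn_indicatorConstLp_of_disjoint hKm hfin hKm.compl disjoint_compl_left 1⟩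
  rw [← norm_pos_iff, norm_indicatorConstLp ne_zero_of_fact_one_le hp, norm_one, one_mul]
  exact Real.rpow_pos_of_pos (ENNReal.toReal_pos hpos hfin) _

theorem IsModerateWeight.exists_small_of_isDenseVector [NoncompactSpace G]
    (hω : IsModerateWeight ω) (hp : p ≠ ∞)
    {S : Set G} {Γ : Set ℂ} {f : WeightedLp μ p ω} (hf : IsDenseVector Γ S f)
    {ε : ℝ} (hε : 0 < ε) :
    ∃ c ∈ Γ \ {0}, ∃ s ∈ S, ‖c‖ * ω s < ε ∧ 1 / ‖c‖ * ω s⁻¹ < ε := by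
  obtain ⟨h, K₀, hK₀, hh, hhK₀⟩ := hω.exists_ne_zero_normOn_compl_eq_zero (μ := μ) hp
  -- If `f = 0`, approximating `h` within `‖h‖` would give `‖h‖ < ‖h‖`.
  have hf0 : 0 < ‖f‖ := by
    obtain ⟨c, -, s, -, -, hcs⟩ := hω.exists_translate_notMem_near hp hf hh hK₀ hhK₀
      isCompact_empty (norm_pos_iff.2 hh)
    rw [norm_pos_iff]
    rintro rfl
    simp at hcs
  obtain ⟨g₁, K₁, hK₁, hg₁, hfg₁⟩ :=
    hω.exists_isCompact_normOn_compl_eq_zero hp f (show 0 < ‖f‖ / 3 by positivity)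
  -- `K` supports `h` and carries at least two thirds of the norm of `f`.
  let K := K₀ ∪ K₁
  have hK : IsCompact K := hK₀.union hK₁
  have hKm : MeasurableSet K := hK.measurableSet
  have hhK : normOn Kᶜ h = 0 := le_antisymm
    ((normOn_mono (Set.compl_subset_compl.2 Set.subset_union_left) h).trans hhK₀.le)
    (normOn_nonneg _ _)
  have hb : 0 < normOn K f := by
    have h1 := norm_le_normOn_add_normOn_compl hK₁.measurableSet f
    have h2 := normOn_le_add_norm_sub K₁ᶜ f g₁
    have h3 := normOn_mono (Set.subset_union_right : K₁ ⊆ K) f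
    linarith
  have ha : 0 < normOn K h := by
    have h1 := norm_le_normOn_add_normOn_compl hKm h
    have h2 := norm_pos_iff.2 hh
    linarith
  obtain ⟨C, hC, hCK⟩ := hω.exists_mul_bounds hK
  obtain ⟨δ, hδ, hδa, hδ1, hδ2⟩ : ∃ δ > 0, δ ≤ normOn K h / 2 ∧ C * δ < ε * normOn K f ∧
      2 * (C * δ) < ε * normOn K h := by
    refine ⟨min (normOn K h / 2) (min (ε * normOn K f / (2 * C)) (ε * normOn K h / (4 * C))),
      by positivity, min_le_left _ _, ?_, ?_⟩
    · calc C * _ ≤ C * (ε * normOn K f / (2 * C)) := mul_le_mul_of_nonneg_left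
            ((min_le_right _ _).trans (min_le_left _ _)) hC.le
        _ = ε * normOn K f / 2 := by field_simp
        _ < _ := half_lt_self (by positivity)
    · calc 2 * (C * _) ≤ 2 * (C * (ε * normOn K h / (4 * C))) := by
            gcongr
            exact (min_le_right _ _).trans (min_le_right _ _)
        _ = ε * normOn K h / 2 := by field_simp; norm_num
        _ < _ := half_lt_self (by positivity)
  obtain ⟨g₂, L, hL, hg₂, hfg₂⟩ := hω.exists_isCompact_normOn_compl_eq_zero hp f hδ
  have hLf : normOn Lᶜ f ≤ δ := by
    have := normOn_le_add_norm_sub Lᶜ f g₂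
    linarith
  -- The excluded compact set is chosen so that `s⁻¹K` misses both `K` and `L`.
  obtain ⟨c, hc, s, hs, hsF, hcs⟩ := hω.exists_translate_notMem_near hp hf hh hK hhK
    ((hK.mul hK.inv).union (hK.mul hL.inv)) hδ
  have hsK : ∀ t ∈ K, s⁻¹ * t ∈ Kᶜ := fun t ht htK =>
    hsF (Or.inl ⟨t, ht, (s⁻¹ * t)⁻¹, by simpa using htK, by simp⟩)
  have hsL : ∀ t ∈ K, s⁻¹ * t ∈ Lᶜ := fun t ht htL =>
    hsF (Or.inr ⟨t, ht, (s⁻¹ * t)⁻¹, by simpa using htL, by simp⟩)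
  have hωs := hω.pos s
  have hωs' := hω.pos s⁻¹
  have h1 : ‖c‖ * ω s * normOn K f ≤ C * δ := by
    let B := (fun t => s⁻¹ * t) ⁻¹' K
    have hB : MeasurableSet B := measurable_const_mul s⁻¹ hKm
    have h2 : normOn K (hω.translate hp s⁻¹ (hω.translate hp s f)) ≤
        C / ω s * normOn B (hω.translate hp s f) :=
      hω.normOn_translate_le hp s⁻¹ _ hKm hB (by positivity) fun t ht => by
        refine ⟨by simpa [B] using ht, ?_⟩
        rw [inv_inv, div_mul_eq_mul_div, le_div_iff₀ hωs, mul_comm]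
        exact (hCK t ht s).2
    rw [← hω.translate_mul, inv_mul_cancel, hω.translate_one, div_mul_eq_mul_div,
      le_div_iff₀ hωs] at h2
    have h3 := normOn_le_add_norm_sub B (c • hω.translate hp s f) h
    have h4 : normOn B h ≤ normOn Kᶜ h := normOn_mono (fun t ht htK => hsK t htK ht) h
    rw [normOn_smul] at h3
    calc ‖c‖ * ω s * normOn K f = ‖c‖ * (normOn K f * ω s) := by ring
      _ ≤ ‖c‖ * (C * normOn B (hω.translate hp s f)) := by gcongr
      _ = C * (‖c‖ * normOn B (hω.translate hp s f)) := by ring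
      _ ≤ C * δ := mul_le_mul_of_nonneg_left (by linarith) hC.le
  have h2 : ω s⁻¹ * normOn K h ≤ ‖c‖ * (2 * (C * δ)) := by
    have h3 : normOn K (hω.translate hp s f) ≤ C / ω s⁻¹ * normOn Lᶜ f :=
      hω.normOn_translate_le hp s f hKm hL.measurableSet.compl (by positivity) fun t ht => by
        refine ⟨hsL t ht, ?_⟩
        rw [div_mul_eq_mul_div, le_div_iff₀ hωs', mul_comm]
        exact (hCK t ht s⁻¹).2
    rw [div_mul_eq_mul_div, le_div_iff₀ hωs'] at h3
    have h4 := normOn_le_add_norm_sub K h (c • hω.translate hp s f)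
    rw [norm_sub_rev, normOn_smul] at h4
    have h5 : normOn K h ≤ 2 * (‖c‖ * normOn K (hω.translate hp s f)) := by linarith
    calc ω s⁻¹ * normOn K h ≤ ω s⁻¹ * (2 * (‖c‖ * normOn K (hω.translate hp s f))) := by gcongr
      _ = ‖c‖ * (2 * (normOn K (hω.translate hp s f) * ω s⁻¹)) := by ring
      _ ≤ ‖c‖ * (2 * (C * normOn Lᶜ f)) := by gcongr
      _ ≤ ‖c‖ * (2 * (C * δ)) := by gcongr
  -- `Γ` may contain `0`, but `c = 0` would make the positive left side of `h2` at most `0`.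
  have hc0 : 0 < ‖c‖ := by
    refine (norm_nonneg c).lt_of_ne fun h0 => ?_
    rw [← h0, zero_mul] at h2
    exact h2.not_gt (by positivity)
  refine ⟨c, ⟨hc, norm_pos_iff.1 hc0⟩, s, hs, ?_, ?_⟩
  · exact lt_of_mul_lt_mul_right (h1.trans_lt hδ1) hb.le
  · rw [one_div_mul_eq_div, div_lt_iff₀ hc0]
    refine lt_of_mul_lt_mul_right ?_ ha.le
    calc ω s⁻¹ * normOn K h ≤ ‖c‖ * (2 * (C * δ)) := h2
      _ < ‖c‖ * (ε * normOn K h) := by gcongr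
      _ = _ := by ring

end

/-! ### The equivalence of the three conditions -/

theorem proposition25 {G : Type*} [Group G] [TopologicalSpace G] [IsTopologicalGroup G]
    [T2Space G] [LocallyCompactSpace G] [SecondCountableTopology G] [NoncompactSpace G]
    [MeasurableSpace G] [BorelSpace G] (μ : Measure G) [μ.IsHaarMeasure]
    (S : Set G) (p : ℝ≥0∞) [Fact (1 ≤ p)] (ω : G → ℝ) (Γ : Set ℂ)
    (hadm : IsAdmissibleTuple μ S p ω Γ) (hcont : Continuous ω)
    (hM : ∀ s : G, leftBound ω s < ∞) (hR : ∀ s : G, rightBound ω s < ∞) :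
    List.TFAE [
      ∃ f : WeightedLp μ p ω, IsDenseVector Γ S f,
      ∀ K : Set G, IsCompact K →
        ∃ (s : ℕ → G) (c : ℕ → ℂ), (∀ n, s n ∈ S) ∧ (∀ n, c n ∈ Γ \ {0}) ∧
          Tendsto (fun n => ‖c n‖ * ⨆ t : K, ω (s n * t)) atTop (𝓝 0) ∧
          Tendsto (fun n => 1 / ‖c n‖ * ⨆ t : K, ω ((s n)⁻¹ * t)) atTop (𝓝 0),
      ∃ (s : ℕ → G) (c : ℕ → ℂ), (∀ n, s n ∈ S) ∧ (∀ n, c n ∈ Γ \ {0}) ∧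
          Tendsto (fun n => ‖c n‖ * ω (s n)) atTop (𝓝 0) ∧
          Tendsto (fun n => 1 / ‖c n‖ * ω ((s n)⁻¹)) atTop (𝓝 0)] := by
  have hω : IsModerateWeight ω :=
    ⟨hcont, hadm.pos, fun s => le_mul_of_iSup_ofReal_div_lt_top hadm.pos (hM s),
      fun s => le_mul_of_iSup_ofReal_div_lt_top hadm.pos (hR s)⟩
  have hp := hadm.p_ne_top
  tfae_have 1 → 3 := by
    rintro ⟨f, hf⟩
    choose c hc s hs h1 h2 using fun n : ℕ =>
      hω.exists_small_of_isDenseVector hp hf (Nat.one_div_pos_of_nat (α := ℝ) (n := n))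
    refine ⟨s, c, hs, hc,
      squeeze_zero (fun n => ?_) (fun n => (h1 n).le) tendsto_one_div_add_atTop_nhds_zero_nat,
      squeeze_zero (fun n => ?_) (fun n => (h2 n).le) tendsto_one_div_add_atTop_nhds_zero_nat⟩
    · have := hω.pos (s n)
      positivity
    · have := hω.pos (s n)⁻¹
      positivity
  tfae_have 3 → 1 := fun ⟨s, c, hs, hc, h1, h2⟩ => hω.exists_isDenseVector hp hs hc h1 h2
  tfae_have 3 → 2 := by
    rintro ⟨s, c, hs, hc, h1, h2⟩ K hK
    obtain ⟨C, hC, h⟩ := hω.exists_right_bound hK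
    -- The real supremum over an empty `K` is `0`, hence the need for a nonnegative bound.
    have hle : ∀ x, ⨆ t : K, ω (x * t) ≤ C * ω x := fun x =>
      Real.iSup_le (fun t => h t t.2 x) (mul_nonneg hC.le (hω.pos x).le)
    have hnn : ∀ x, 0 ≤ ⨆ t : K, ω (x * t) := fun x => Real.iSup_nonneg fun t => (hω.pos _).le
    refine ⟨s, c, hs, hc,
      squeeze_zero (g := fun n => C * (‖c n‖ * ω (s n)))
        (fun n => mul_nonneg (norm_nonneg _) (hnn _)) (fun n => ?_) (by simpa using h1.const_mul C),
      squeeze_zero (g := fun n => C * (1 / ‖c n‖ * ω (s n)⁻¹))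
        (fun n => mul_nonneg (by positivity) (hnn _)) (fun n => ?_)
        (by simpa using h2.const_mul C)⟩
    · rw [mul_left_comm]
      exact mul_le_mul_of_nonneg_left (hle _) (norm_nonneg _)
    · rw [mul_left_comm]
      exact mul_le_mul_of_nonneg_left (hle _) (by positivity)
  tfae_have 2 → 3 := by
    intro h
    obtain ⟨s, c, hs, hc, h1, h2⟩ := h {1} isCompact_singleton
    refine ⟨s, c, hs, hc, ?_, ?_⟩
    · simpa using h1
    · simpa using h2
  tfae_finish
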